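/- Let $G$ be a compact Hausdorff topological group with a countable basis, let $-\mathbb N=\{0,-1,-2,\dots\}$, and let $(\mu_k)_{k\in-\mathbb N}$ be a family of Borel probability laws on $G$. Convergence of laws is weak convergence, $*$ is convolution, $\delta_g$ is the point mass at $g$; for a compact subgroup $H$ of $G$, $\omega_H$ denotes the normalized Haar measure on $H$, regarded as a law on $G$, and $G/H$ the space of left cosets $gH$ with the quotient topology. There exist a sequence $(\lambda_k)_{k\in-\mathbb N}$ of probability laws on $G$, a sequence $(\alpha_l)_{l\in-\mathbb N}$ of elements of $G$, and a compact subgroup $H$ of $G$ such that - (I1) $\mu_k*\mu_{k-1}*\cdots*\mu_l*\delta_{\alpha_l}\to\lambda_k$ as $l\to-\infty$, for each $k\in-\mathbb N$; - (I2) $\delta_{\alpha_l^{-1}}*\lambda_{l-1}\to\omega_H$ as $l\to-\infty$; - (I3) $\lambda_k*\delta_h=\lambda_k$ for each $h\in H$ and each $k\in-\mathbb N$; - (I4) if $(\xi_k)_{k\in-\mathbb N}$ are independent $G$-valued random variables such that each $\xi_k$ has law $\mu_k$, then for each $k\in-\mathbb N$ the sequence $\xi_k\xi_{k-1}\cdots\xi_l\,\alpha_l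 H$ converges almost surely in $G/H$ as $l\to-\infty$. Moreover, if $((\lambda_k),(\alpha_l),H)$ and $((\tilde\lambda_k),(\tilde\alpha_l),\tilde H)$ both satisfy (I1)-(I4), then $$\tilde\lambda_k=\lambda_k*\delta_g\quad(k\in-\mathbb N),\qquad \tilde H=g^{-1}Hg$$ for every accumulation point $g$ of the sequence $(\alpha_l^{-1}\tilde\alpha_l)$ as $l\to-\infty$ (that is, every limit of a subsequence along some $l(j)\to-\infty$). -/

import Mathlib

universe u v

open MeasureTheory ProbabilityTheory Filter Topology TopologicalSpace

/-! The index set `{0, -1, -2, …}` is represented by `ℕ` through `k = -n`: the term with index `-n` of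
a sequence is its value at `n : ℕ`, the index `k - 1` becomes `n + 1`, and the limit `l → -∞` becomes
a limit along `atTop`. -/

namespace InfiniteConvolution

noncomputable section

section Products

variable {G : Type u} [Group G]

/-- The ordered product `x_n x_{n+1} ⋯ x_{n+j}`, that is, `x_k x_{k-1} ⋯ x_l` for
`k = -n` and `l = -(n + j)`. -/
def partialProd (x : ℕ → G) (n : ℕ) : ℕ → G
  | 0 => x n
  | j + 1 => partialProd x n j * x (n + (j + 1))

variable [MeasurableSpace G] [MeasurableMul₂ G]

/-- The convolution of two probability laws on `G`. -/
def conv (μ ν : ProbabilityMeasure G) : ProbabilityMeasure G :=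
  ⟨Measure.mconv (μ : Measure G) (ν : Measure G), inferInstance⟩

/-- The ordered convolution `μ_n * μ_{n+1} * ⋯ * μ_{n+j}`, that is, `μ_k * μ_{k-1} * ⋯ * μ_l` for
`k = -n` and `l = -(n + j)`. -/
def partialConv (μ : ℕ → ProbabilityMeasure G) (n : ℕ) : ℕ → ProbabilityMeasure G
  | 0 => μ n
  | j + 1 => conv (partialConv μ n j) (μ (n + (j + 1)))

end Products

section Limits

variable {G : Type u} [Group G] [TopologicalSpace G] [IsTopologicalGroup G]
  [MeasurableSpace G] [BorelSpace G]

/-- The normalized Haar measure `ω_H` of a compact subgroup `H`, as a probability law on `G`. -/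
def haarLaw (H : Subgroup G) (hH : IsCompact (H : Set G)) : ProbabilityMeasure G :=
  haveI : CompactSpace H := isCompact_iff_compactSpace.mp hH
  ⟨(Measure.haarMeasure (⊤ : PositiveCompacts H)).map (Subtype.val : H → G), by
    have : IsProbabilityMeasure (Measure.haarMeasure (⊤ : PositiveCompacts H)) :=
      ⟨by simpa using Measure.haarMeasure_self (K₀ := (⊤ : PositiveCompacts H))⟩
    exact Measure.isProbabilityMeasure_map measurable_subtype_coe.aemeasurable⟩

/-- The laws `lam k`, the elements `α l` and the compact subgroup `H` describe the limits of the
infinite convolution products of `μ`. -/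
structure IsLimitTriple [SecondCountableTopology G] (μ lam : ℕ → ProbabilityMeasure G) (α : ℕ → G)
    (H : Subgroup G) : Prop where
  isCompact : IsCompact (H : Set G)
  /-- `μ_k * μ_{k-1} * ⋯ * μ_l * δ_{α_l} → λ_k` weakly as `l → -∞`. -/
  tendsto_conv : ∀ n : ℕ,
    Tendsto (fun j : ℕ => conv (partialConv μ n j) (diracProba (α (n + j)))) atTop (𝓝 (lam n))
  /-- `δ_{α_l⁻¹} * λ_{l-1} → ω_H` weakly as `l → -∞`. -/
  tendsto_haar :
    Tendsto (fun m : ℕ => conv (diracProba (α m)⁻¹) (lam (m + 1))) atTop (𝓝 (haarLaw H isCompact))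
  /-- `λ_k * δ_h = λ_k` for `h ∈ H`. -/
  conv_dirac : ∀ n : ℕ, ∀ h ∈ H, conv (lam n) (diracProba h) = lam n
  /-- For independent `ξ_k` with laws `μ_k`, the cosets `ξ_k ξ_{k-1} ⋯ ξ_l α_l H` converge
  almost surely in `G/H` as `l → -∞`. -/
  ae_tendsto : ∀ (Ω : Type v) [MeasurableSpace Ω] (P : Measure Ω) [IsProbabilityMeasure P]
    (ξ : ℕ → Ω → G), (∀ n, Measurable (ξ n)) → iIndepFun ξ P →
    (∀ n, P.map (ξ n) = (μ n : Measure G)) →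
    ∀ n : ℕ, ∀ᵐ ω ∂P, ∃ x : G ⧸ H,
      Tendsto (fun j : ℕ => ((partialProd (fun i => ξ i ω) n j * α (n + j) : G) : G ⧸ H))
        atTop (𝓝 x)

end Limits

end

end InfiniteConvolution

namespace InfiniteConvolution

/-! ### Convolution of laws and absorption by invariant laws. -/

section Algebra

variable {G : Type u} [Group G] [MeasurableSpace G] [MeasurableMul₂ G]

/-! The space of laws is compact, so fix a free ultrafilter `V` and let `λ_n` be the `V`-limit of
`μ_n * ⋯ * μ_l`, and `ν` the `V`-limit of `λ_{p+1}`. Passing to the limit in `λ_n = (μ_n * ⋯ * μ_p)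
* λ_{p+1}` gives `λ_n * ν = λ_n`, hence `ν * ν = ν`. An idempotent law is a Haar law `ω_H`
(`exists_eq_haarLaw_of_idempotent`), which yields (I3).

Along any other ultrafilter, a limit `B` of `λ_{m+1}` is a right factor of every `λ_n`, hence of
`ω_H`, and so is a left translate of `ω_H`; `exists_tendsto_dirac_conv` turns this into one sequence
`α` satisfying (I2). For (I1), any limit of `μ_n * ⋯ * μ_l * δ_{α_l}` has the form `λ_n * K` with
`K` carried by `H`, so equals `λ_n`.

For (I4), averaging a function on `G/H` over `λ_{l+1}` after the random walk gives a bounded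
martingale. By (I2) its limit is the value of the function at any limit coset, so countably many
functions determine that coset (`ae_tendsto_coset`).

Uniqueness follows by passing to the limit in (I1) and (I2) along an ultrafilter on which `α_l⁻¹
α'_l → g`. -/

lemma conv_assoc (μ ν ρ : ProbabilityMeasure G) :
    conv (conv μ ν) ρ = conv μ (conv ν ρ) :=
  Subtype.ext (Measure.mconv_assoc _ _ _)

lemma dirac_one_conv (μ : ProbabilityMeasure G) : conv (diracProba 1) μ = μ :=
  Subtype.ext (Measure.dirac_one_mconv _)

lemma conv_dirac_one (μ : ProbabilityMeasure G) : conv μ (diracProba 1) = μ :=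
  Subtype.ext (Measure.mconv_dirac_one _)

lemma dirac_conv_dirac (x y : G) :
    conv (diracProba x) (diracProba y) = diracProba (x * y) :=
  Subtype.ext (Measure.dirac_mconv_dirac x y)

lemma dirac_conv_inv_cancel (x : G) (μ : ProbabilityMeasure G) :
    conv (diracProba x) (conv (diracProba x⁻¹) μ) = μ := by
  rw [← conv_assoc, dirac_conv_dirac, mul_inv_cancel, dirac_one_conv]

lemma conv_apply (μ ν : ProbabilityMeasure G) {s : Set G} (hs : MeasurableSet s) :
    (conv μ ν : Measure G) s = ∫⁻ x, (conv (diracProba x) ν : Measure G) s ∂(μ : Measure G) := by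
  have h : ∀ ρ : ProbabilityMeasure G, (conv ρ ν : Measure G) s
      = ∫⁻ x, ∫⁻ y, s.indicator 1 (x * y) ∂(ν : Measure G) ∂(ρ : Measure G) := fun ρ => by
    rw [← lintegral_indicator_one hs]
    exact Measure.lintegral_mconv (measurable_one.indicator hs)
  have hm : Measurable fun x : G => ∫⁻ y, s.indicator (1 : G → ENNReal) (x * y) ∂(ν : Measure G) :=
    ((measurable_one.indicator hs).comp measurable_mul).lintegral_prod_right'
  rw [h]
  refine lintegral_congr fun x => ?_
  rw [h]
  exact (lintegral_dirac' x hm).symm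

lemma conv_apply_right (μ ν : ProbabilityMeasure G) {s : Set G} (hs : MeasurableSet s) :
    (conv μ ν : Measure G) s = ∫⁻ y, (conv μ (diracProba y) : Measure G) s ∂(ν : Measure G) := by
  have h : ∀ ρ : ProbabilityMeasure G, (conv μ ρ : Measure G) s
      = ∫⁻ y, ∫⁻ x, s.indicator 1 (x * y) ∂(μ : Measure G) ∂(ρ : Measure G) := fun ρ => by
    rw [← lintegral_indicator_one hs, lintegral_lintegral_swap]
    · exact Measure.lintegral_mconv (measurable_one.indicator hs)
    · exact ((measurable_one.indicator hs).comp
        (measurable_mul.comp measurable_swap)).aemeasurable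
  have hm : Measurable fun y : G => ∫⁻ x, s.indicator (1 : G → ENNReal) (x * y) ∂(μ : Measure G) :=
    ((measurable_one.indicator hs).comp measurable_mul).lintegral_prod_left'
  rw [h]
  refine lintegral_congr fun x => ?_
  rw [h]
  exact (lintegral_dirac' x hm).symm

lemma dirac_conv_apply (x : G) (ν : ProbabilityMeasure G) {s : Set G} (hs : MeasurableSet s) :
    (conv (diracProba x) ν : Measure G) s = (ν : Measure G) ((x * ·) ⁻¹' s) := by
  change (Measure.mconv (Measure.dirac x) (ν : Measure G)) s = _
  rw [Measure.dirac_mconv, Measure.map_apply (measurable_const_mul x) hs]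

lemma conv_dirac_apply (x : G) (ν : ProbabilityMeasure G) {s : Set G} (hs : MeasurableSet s) :
    (conv ν (diracProba x) : Measure G) s = (ν : Measure G) ((· * x) ⁻¹' s) := by
  change (Measure.mconv (ν : Measure G) (Measure.dirac x)) s = _
  rw [Measure.mconv_dirac, Measure.map_apply (measurable_mul_const x) hs]

/-- A law carried by `H` is absorbed by a left `H`-invariant law. -/
lemma conv_eq_right_of_ae_mem {H : Set G} {ν κ : ProbabilityMeasure G}
    (hν : ∀ᵐ x ∂(ν : Measure G), x ∈ H) (hκ : ∀ h ∈ H, conv (diracProba h) κ = κ) :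
    conv ν κ = κ := by
  refine Subtype.ext (Measure.ext fun s hs => ?_)
  refine (conv_apply ν κ hs).trans ?_
  have : ∀ᵐ x ∂(ν : Measure G), (conv (diracProba x) κ : Measure G) s = (κ : Measure G) s := by
    filter_upwards [hν] with x hx
    rw [hκ x hx]
  rw [lintegral_congr_ae this]
  simp

/-- A law carried by `H` is absorbed by a right `H`-invariant law. -/
lemma conv_eq_left_of_ae_mem {H : Set G} {ν κ : ProbabilityMeasure G}
    (hν : ∀ᵐ x ∂(ν : Measure G), x ∈ H) (hκ : ∀ h ∈ H, conv κ (diracProba h) = κ) :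
    conv κ ν = κ := by
  refine Subtype.ext (Measure.ext fun s hs => ?_)
  refine (conv_apply_right κ ν hs).trans ?_
  have : ∀ᵐ x ∂(ν : Measure G), (conv κ (diracProba x) : Measure G) s = (κ : Measure G) s := by
    filter_upwards [hν] with x hx
    rw [hκ x hx]
  rw [lintegral_congr_ae this]
  simp

lemma integral_conv (μ ν : ProbabilityMeasure G) {f : G → ℝ} (hf : Measurable f) {C : ℝ}
    (hC : ∀ x, ‖f x‖ ≤ C) :
    ∫ x, f x ∂(conv μ ν : Measure G) = ∫ x, ∫ y, f (x * y) ∂(ν : Measure G) ∂(μ : Measure G) := by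
  change ∫ x, f x ∂(Measure.map (fun p : G × G => p.1 * p.2) ((μ : Measure G).prod ν)) = _
  rw [integral_map measurable_mul.aemeasurable hf.aestronglyMeasurable]
  refine integral_prod _ (Integrable.of_bound
    (hf.comp measurable_mul).aestronglyMeasurable C (ae_of_all _ fun p => hC _))

/-- The convolution `μ_n * ⋯ * μ_l`, for `n ≤ l`. -/
noncomputable def segConv (μ : ℕ → ProbabilityMeasure G) (n l : ℕ) : ProbabilityMeasure G :=
  partialConv μ n (l - n)

lemma partialConv_add (μ : ℕ → ProbabilityMeasure G) (n i j : ℕ) :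
    partialConv μ n (i + 1 + j) = conv (partialConv μ n i) (partialConv μ (n + i + 1) j) := by
  induction j with
  | zero => rfl
  | succ j ih =>
    change conv (partialConv μ n (i + 1 + j)) (μ (n + (i + 1 + j + 1))) =
      conv _ (conv _ (μ (n + i + 1 + (j + 1))))
    rw [ih, conv_assoc]
    congr 3
    ring

lemma segConv_eq_conv (μ : ℕ → ProbabilityMeasure G) {n p l : ℕ} (hnp : n ≤ p) (hpl : p < l) :
    segConv μ n l = conv (segConv μ n p) (segConv μ (p + 1) l) := by
  obtain ⟨i, rfl⟩ := Nat.exists_eq_add_of_le hnp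
  obtain ⟨j, rfl⟩ := Nat.exists_eq_add_of_le hpl
  have h1 : n + i + 1 + j - n = i + 1 + j := by omega
  simp only [segConv, h1, partialConv_add, Nat.add_sub_cancel_left]

lemma segConv_self (μ : ℕ → ProbabilityMeasure G) (n : ℕ) : segConv μ n n = μ n := by
  simp [segConv, partialConv]

end Algebra

/-! ### Weak continuity of convolution, and averaging operators. -/

section Topological

set_option linter.unusedSectionVars false

variable {G : Type u} [Group G] [TopologicalSpace G] [IsTopologicalGroup G]
  [CompactSpace G] [T2Space G] [SecondCountableTopology G] [MeasurableSpace G] [BorelSpace G]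

lemma continuous_conv :
    Continuous fun p : ProbabilityMeasure G × ProbabilityMeasure G => conv p.1 p.2 := by
  have h : Continuous fun p : G × G => p.1 * p.2 := continuous_mul
  exact (ProbabilityMeasure.continuous_map h).comp ProbabilityMeasure.continuous_prod

lemma tendsto_conv_nhds {ι : Type*} {l : Filter ι} {f g : ι → ProbabilityMeasure G}
    {μ ν : ProbabilityMeasure G} (hf : Tendsto f l (𝓝 μ)) (hg : Tendsto g l (𝓝 ν)) :
    Tendsto (fun i => conv (f i) (g i)) l (𝓝 (conv μ ν)) :=
  (continuous_conv.tendsto (μ, ν)).comp (hf.prodMk_nhds hg)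

lemma tendsto_dirac {ι : Type*} {l : Filter ι} {f : ι → G} {x : G} (hf : Tendsto f l (𝓝 x)) :
    Tendsto (fun i => diracProba (f i)) l (𝓝 (diracProba x)) :=
  (continuous_diracProba.tendsto x).comp hf

/-- Replaces extraction of subsequences, both in `G` and in the compact space of laws: one
ultrafilter serves all indices `n` at once. -/
lemma exists_tendsto_ultrafilter {ι X : Type*} [TopologicalSpace X] [CompactSpace X]
    (U : Ultrafilter ι) (f : ι → X) : ∃ x, Tendsto f U (𝓝 x) :=
  ⟨_, (U.map f).le_nhds_lim⟩

lemma continuous_integral (f : C(G, ℝ)) :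
    Continuous fun μ : ProbabilityMeasure G => ∫ x, f x ∂(μ : Measure G) := by
  refine continuous_iff_continuousAt.2 fun μ => ?_
  exact (ProbabilityMeasure.tendsto_iff_forall_integral_tendsto.1 tendsto_id)
    (BoundedContinuousFunction.mkOfCompact f)

lemma ext_of_integral {μ ν : ProbabilityMeasure G}
    (h : ∀ f : C(G, ℝ), ∫ x, f x ∂(μ : Measure G) = ∫ x, f x ∂(ν : Measure G)) : μ = ν :=
  Subtype.ext (ext_of_forall_integral_eq_of_IsFiniteMeasure (μ := (μ : Measure G))
    (ν := (ν : Measure G)) fun f => h f.toContinuousMap)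

lemma integral_dirac_conv (x : G) (ν : ProbabilityMeasure G) (f : C(G, ℝ)) :
    ∫ y, f y ∂(conv (diracProba x) ν : Measure G) = ∫ y, f (x * y) ∂(ν : Measure G) := by
  change ∫ y, f y ∂(Measure.mconv (Measure.dirac x) (ν : Measure G)) = _
  rw [Measure.dirac_mconv, integral_map (measurable_const_mul x).aemeasurable
    f.continuous.measurable.aestronglyMeasurable]

/-- The function `x ↦ ∫ f (x y) dν(y)`. -/
noncomputable def rightAvg (ν : ProbabilityMeasure G) (f : C(G, ℝ)) : C(G, ℝ) where
  toFun x := ∫ y, f (x * y) ∂(ν : Measure G)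
  continuous_toFun := by
    simp_rw [← integral_dirac_conv]
    exact (continuous_integral f).comp
      (continuous_conv.comp (continuous_diracProba.prodMk continuous_const))

lemma rightAvg_apply (ν : ProbabilityMeasure G) (f : C(G, ℝ)) (x : G) :
    rightAvg ν f x = ∫ y, f (x * y) ∂(ν : Measure G) := rfl

lemma rightAvg_conv (μ ν : ProbabilityMeasure G) (f : C(G, ℝ)) :
    rightAvg (conv μ ν) f = rightAvg μ (rightAvg ν f) := by
  ext x
  simp only [rightAvg_apply]
  rw [integral_conv μ ν (f := fun y => f (x * y)) (by fun_prop) (C := ‖f‖)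
    (fun y => f.norm_coe_le_norm _)]
  simp only [mul_assoc]

end Topological

/-! ### Haar laws of compact subgroups and idempotent laws. -/

section Haar

set_option linter.unusedSectionVars false

variable {G : Type u} [Group G] [TopologicalSpace G] [IsTopologicalGroup G]
  [CompactSpace G] [T2Space G] [SecondCountableTopology G] [MeasurableSpace G] [BorelSpace G]

lemma haarLaw_toMeasure (H : Subgroup G) (hH : IsCompact (H : Set G)) [CompactSpace H] :
    (haarLaw H hH : Measure G) =
      (Measure.haarMeasure (⊤ : PositiveCompacts H)).map (Subtype.val : H → G) := rfl

lemma ae_mem_haarLaw (H : Subgroup G) (hH : IsCompact (H : Set G)) :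
    ∀ᵐ x ∂(haarLaw H hH : Measure G), x ∈ H := by
  have : CompactSpace H := isCompact_iff_compactSpace.mp hH
  rw [haarLaw_toMeasure, ae_map_iff measurable_subtype_coe.aemeasurable
    (p := (· ∈ H)) hH.isClosed.measurableSet]
  exact ae_of_all _ fun x => x.2

/-- Haar measure charges every nonempty open subset of `H`, so a conull set is dense in `H`. -/
lemma subset_of_ae_mem_haarLaw (H : Subgroup G) (hH : IsCompact (H : Set G)) {C : Set G}
    (hC : IsClosed C) (h : ∀ᵐ x ∂(haarLaw H hH : Measure G), x ∈ C) : (H : Set G) ⊆ C := by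
  have : CompactSpace H := isCompact_iff_compactSpace.mp hH
  rw [haarLaw_toMeasure, ae_map_iff measurable_subtype_coe.aemeasurable
    (p := (· ∈ C)) hC.measurableSet] at h
  have hcl : IsClosed {x : H | (x : G) ∈ C} := hC.preimage continuous_subtype_val
  have hd : Dense {x : H | (x : G) ∈ C} := Measure.dense_of_ae h
  intro x hx
  have : (⟨x, hx⟩ : H) ∈ closure {x : H | (x : G) ∈ C} := hd _
  rw [hcl.closure_eq] at this
  exact this

lemma dirac_conv_haarLaw (H : Subgroup G) (hH : IsCompact (H : Set G)) {h : G} (hh : h ∈ H) :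
    conv (diracProba h) (haarLaw H hH) = haarLaw H hH := by
  have : CompactSpace H := isCompact_iff_compactSpace.mp hH
  refine Subtype.ext ?_
  change (Measure.mconv (Measure.dirac h) (haarLaw H hH : Measure G)) = (haarLaw H hH : Measure G)
  rw [Measure.dirac_mconv, haarLaw_toMeasure,
    Measure.map_map (measurable_const_mul h) measurable_subtype_coe]
  have e : (h * ·) ∘ (Subtype.val : H → G) = Subtype.val ∘ ((⟨h, hh⟩ : H) * ·) := rfl
  rw [e, ← Measure.map_map measurable_subtype_coe (measurable_const_mul _),
    map_mul_left_eq_self]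

lemma haarLaw_conv_dirac (H : Subgroup G) (hH : IsCompact (H : Set G)) {h : G} (hh : h ∈ H) :
    conv (haarLaw H hH) (diracProba h) = haarLaw H hH := by
  have : CompactSpace H := isCompact_iff_compactSpace.mp hH
  have : IsProbabilityMeasure (Measure.haarMeasure (⊤ : PositiveCompacts H)) :=
    ⟨by simpa using Measure.haarMeasure_self (K₀ := (⊤ : PositiveCompacts H))⟩
  have : IsProbabilityMeasure (Measure.map (· * (⟨h, hh⟩ : H))
      (Measure.haarMeasure (⊤ : PositiveCompacts H))) :=
    Measure.isProbabilityMeasure_map (measurable_mul_const _).aemeasurable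
  refine Subtype.ext ?_
  change (Measure.mconv (haarLaw H hH : Measure G) (Measure.dirac h)) = (haarLaw H hH : Measure G)
  rw [Measure.mconv_dirac, haarLaw_toMeasure,
    Measure.map_map (measurable_mul_const h) measurable_subtype_coe]
  have e : (· * h) ∘ (Subtype.val : H → G) = Subtype.val ∘ (· * (⟨h, hh⟩ : H)) := rfl
  -- A right translate of Haar measure is again a left-invariant probability measure, so uniqueness
  -- applies.
  rw [e, ← Measure.map_map measurable_subtype_coe (measurable_mul_const _),
    Measure.isHaarMeasure_eq_of_isProbabilityMeasure (Measure.map (· * (⟨h, hh⟩ : H))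
      (Measure.haarMeasure ⊤)) (Measure.haarMeasure ⊤)]

/-- Compute `ω_H * ν` in two ways: each factor absorbs the other. -/
lemma eq_haarLaw_of_left_invariant {H : Subgroup G} (hH : IsCompact (H : Set G))
    {ν : ProbabilityMeasure G} (hν : ∀ᵐ x ∂(ν : Measure G), x ∈ H)
    (hinv : ∀ h ∈ H, conv (diracProba h) ν = ν) : ν = haarLaw H hH := by
  have h := conv_eq_right_of_ae_mem (H := (H : Set G)) (ae_mem_haarLaw H hH) hinv
  exact h.symm.trans (conv_eq_left_of_ae_mem (H := (H : Set G)) hν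
    fun h hh => haarLaw_conv_dirac H hH hh)

lemma eq_haarLaw_of_right_invariant {H : Subgroup G} (hH : IsCompact (H : Set G))
    {ν : ProbabilityMeasure G} (hν : ∀ᵐ x ∂(ν : Measure G), x ∈ H)
    (hinv : ∀ h ∈ H, conv ν (diracProba h) = ν) : ν = haarLaw H hH := by
  have h := conv_eq_left_of_ae_mem (H := (H : Set G)) (ae_mem_haarLaw H hH) hinv
  exact h.symm.trans (conv_eq_right_of_ae_mem (H := (H : Set G)) hν
    fun h hh => dirac_conv_haarLaw H hH hh)

/-- If `A * ω_H = ω_H`, then `A` is carried by `H`. -/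
lemma ae_mem_of_conv_haarLaw {H : Subgroup G} (hH : IsCompact (H : Set G))
    {A : ProbabilityMeasure G} (h : conv A (haarLaw H hH) = haarLaw H hH) :
    ∀ᵐ x ∂(A : Measure G), x ∈ H := by
  have hm : MeasurableSet (H : Set G) := hH.isClosed.measurableSet
  have h1 := conv_apply_right A (haarLaw H hH) hm.compl
  rw [h, show (haarLaw H hH : Measure G) (H : Set G)ᶜ = 0 from ae_mem_haarLaw H hH] at h1
  have h2 : ∀ᵐ y ∂(haarLaw H hH : Measure G),
      (conv A (diracProba y) : Measure G) (H : Set G)ᶜ = (A : Measure G) (H : Set G)ᶜ := by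
    filter_upwards [ae_mem_haarLaw H hH] with y hy
    rw [conv_dirac_apply y A hm.compl]
    congr 1
    ext x
    simp [Subgroup.mul_mem_cancel_right H hy]
  rw [lintegral_congr_ae h2] at h1
  have h3 : (A : Measure G) (H : Set G)ᶜ = 0 := by simpa using h1.symm
  exact h3

/-- If `A * B = ω_H` and `B` is right `H`-invariant, then `B` is a left translate of `ω_H`. -/
lemma exists_dirac_conv_eq_haarLaw {H : Subgroup G} (hH : IsCompact (H : Set G))
    {A B : ProbabilityMeasure G} (h : conv A B = haarLaw H hH)
    (hB : ∀ h ∈ H, conv B (diracProba h) = B) :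
    ∃ a, conv (diracProba a) B = haarLaw H hH := by
  have hm : MeasurableSet (H : Set G) := hH.isClosed.measurableSet
  have h1 := conv_apply A B hm.compl
  rw [h, show (haarLaw H hH : Measure G) (H : Set G)ᶜ = 0 from ae_mem_haarLaw H hH] at h1
  -- The mass of `Hᶜ` under `A * B` is the `A`-average of its masses under the translates of `B`;
  -- the average vanishes, so some translate is carried by `H`.
  by_contra! hne
  have h2 : ∀ a, (conv (diracProba a) B : Measure G) (H : Set G)ᶜ ≠ 0 := fun a ha => by
    refine hne a (eq_haarLaw_of_right_invariant hH ha fun k hk => ?_)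
    rw [conv_assoc, hB k hk]
  have hmeas : Measurable fun a => (conv (diracProba a) B : Measure G) (H : Set G)ᶜ := by
    simp_rw [dirac_conv_apply _ B hm.compl]
    exact measurable_measure_prodMk_left (measurable_mul hm.compl)
  rw [eq_comm, lintegral_eq_zero_iff hmeas] at h1
  obtain ⟨a, ha⟩ := h1.exists
  exact h2 a ha

/-- A nonempty compact subsemigroup of a Hausdorff group contains the inverses of its elements. -/
lemma inv_mem_of_isCompact_of_mul_mem {S : Set G} (hS : IsCompact S)
    (hmul : ∀ᵉ (x ∈ S) (y ∈ S), x * y ∈ S) {x : G} (hx : x ∈ S) : x⁻¹ ∈ S := by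
  -- The only idempotent of a group is `1`, so an idempotent in the compact semigroup `xS` provides
  -- `s ∈ S` with `x s = 1`.
  obtain ⟨m, ⟨s, hs, rfl⟩, hm⟩ := exists_idempotent_in_compact_subsemigroup
    (fun r : G => continuous_mul_const r) ((x * ·) '' S) (Set.Nonempty.image _ ⟨x, hx⟩)
    (hS.image (continuous_const_mul x)) (by
      rintro _ ⟨s, hs, rfl⟩ _ ⟨t, ht, rfl⟩
      exact ⟨s * (x * t), hmul _ hs _ (hmul _ hx _ ht), by simp [mul_assoc]⟩)
  have : x * s = 1 := by simpa using hm
  rwa [inv_eq_of_mul_eq_one_right this]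

lemma mul_mem_support_of_idempotent {ν : ProbabilityMeasure G} (hν : conv ν ν = ν) {x y : G}
    (hx : x ∈ (ν : Measure G).support) (hy : y ∈ (ν : Measure G).support) :
    x * y ∈ (ν : Measure G).support := by
  rw [Measure.mem_support_iff_forall] at *
  intro U hU
  obtain ⟨U', hU'U, hU'o, hxy⟩ := mem_nhds_iff.1 hU
  have hpre : (fun p : G × G => p.1 * p.2) ⁻¹' U' ∈ 𝓝 (x, y) :=
    (hU'o.preimage continuous_mul).mem_nhds hxy
  rw [nhds_prod_eq] at hpre
  obtain ⟨V, hV, W, hW, hVW⟩ := Filter.mem_prod_iff.1 hpre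
  refine lt_of_lt_of_le ?_ (measure_mono hU'U)
  rw [← hν]
  change 0 < (Measure.map (fun p : G × G => p.1 * p.2) ((ν : Measure G).prod ν)) U'
  rw [Measure.map_apply measurable_mul hU'o.measurableSet]
  refine lt_of_lt_of_le ?_ (measure_mono hVW)
  rw [Measure.prod_prod]
  exact ENNReal.mul_pos (hx V hV).ne' (hy W hW).ne'

/-- A continuous function that equals its averages against `ν` is constant on the support of `ν`,
when that support is a subgroup. -/
lemma eq_of_rightAvg_eq_self {ν : ProbabilityMeasure G} {H : Subgroup G}
    (hH : (H : Set G) = (ν : Measure G).support) {F : C(G, ℝ)} (hF : rightAvg ν F = F)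
    {h : G} (hh : h ∈ H) : F h = F 1 := by
  have hcl : IsClosed (H : Set G) := hH ▸ Measure.isClosed_support
  have hae : ∀ᵐ y ∂(ν : Measure G), y ∈ H := by
    have : (ν : Measure G).support ∈ ae (ν : Measure G) := Measure.support_mem_ae
    rwa [← hH] at this
  -- Maximum principle: the maximum `F g` over `H` is the `ν`-average of the values `F (g y) ≤ F g`,
  -- so equality holds on the support, and `gH = H`.
  obtain ⟨g, hg, hmax⟩ := hcl.isCompact.exists_isMaxOn ⟨1, H.one_mem⟩ F.continuous.continuousOn
  have hint : ∫ y, (F g - F (g * y)) ∂(ν : Measure G) = 0 := by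
    rw [integral_sub (integrable_const _)]
    · have := congrArg (fun f : C(G, ℝ) => f g) hF
      rw [rightAvg_apply] at this
      simp [this]
    · exact Integrable.of_bound (by fun_prop) ‖F‖ (ae_of_all _ fun y => F.norm_coe_le_norm _)
  have hnn : 0 ≤ᵐ[(ν : Measure G)] fun y => F g - F (g * y) := by
    filter_upwards [hae] with y hy
    exact sub_nonneg.2 (hmax (H.mul_mem hg hy))
  have hz := (integral_eq_zero_iff_of_nonneg_ae hnn (Integrable.of_bound (by fun_prop)
    (‖F‖ + ‖F‖) (ae_of_all _ fun y => (norm_sub_le _ _).trans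
      (add_le_add (F.norm_coe_le_norm _) (F.norm_coe_le_norm _))))).1 hint
  have hsub : (H : Set G) ⊆ {y | F g - F (g * y) = 0} := by
    rw [hH]
    exact Measure.support_subset_of_isClosed (isClosed_eq (by fun_prop) (by fun_prop)) hz
  have key : ∀ k ∈ H, F k = F g := fun k hk => by
    have : F g - F (g * (g⁻¹ * k)) = 0 := hsub (H.mul_mem (H.inv_mem hg) hk)
    rw [mul_inv_cancel_left] at this
    linarith
  rw [key h hh, key 1 H.one_mem]

/-- An idempotent law on a compact group is the normalized Haar measure of a compact subgroup. -/
theorem exists_eq_haarLaw_of_idempotent {ν : ProbabilityMeasure G} (hν : conv ν ν = ν) :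
    ∃ (H : Subgroup G) (hH : IsCompact (H : Set G)), ν = haarLaw H hH := by
  have hS : IsCompact (ν : Measure G).support := Measure.isClosed_support.isCompact
  have hmul : ∀ᵉ (x ∈ (ν : Measure G).support) (y ∈ (ν : Measure G).support),
      x * y ∈ (ν : Measure G).support := fun x hx y hy => mul_mem_support_of_idempotent hν hx hy
  obtain ⟨x, hx⟩ : (ν : Measure G).support.Nonempty :=
    Measure.nonempty_support (IsProbabilityMeasure.ne_zero _)
  let H : Subgroup G :=
    { carrier := (ν : Measure G).support
      mul_mem' := fun {a b} ha hb => hmul a ha b hb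
      one_mem' := by
        have := hmul x hx _ (inv_mem_of_isCompact_of_mul_mem hS hmul hx)
        rwa [mul_inv_cancel] at this
      inv_mem' := fun {a} ha => inv_mem_of_isCompact_of_mul_mem hS hmul ha }
  have hae : ∀ᵐ y ∂(ν : Measure G), y ∈ H :=
    (Measure.support_mem_ae : (ν : Measure G).support ∈ ae (ν : Measure G))
  refine ⟨H, hS, eq_haarLaw_of_left_invariant hS hae fun h hh => ext_of_integral fun f => ?_⟩
  -- Constancy of `rightAvg ν f` on `H` is exactly left `H`-invariance of `ν`, tested on `f`.
  have hF : rightAvg ν (rightAvg ν f) = rightAvg ν f := by rw [← rightAvg_conv, hν]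
  have := eq_of_rightAvg_eq_self (H := H) rfl hF hh
  rw [rightAvg_apply, rightAvg_apply] at this
  rw [integral_dirac_conv, this]
  simp

end Haar

/-! ### Martingales and almost sure convergence of cosets. -/

section AlmostSure

set_option linter.unusedSectionVars false

variable {G : Type u} [Group G] [TopologicalSpace G] [IsTopologicalGroup G]
  [CompactSpace G] [T2Space G] [SecondCountableTopology G] [MeasurableSpace G] [BorelSpace G]

/-- Conditioning a function of `X Y` on a σ-algebra for which `X` is measurable and of which `Y` is
independent amounts to averaging over `Y`. -/
lemma condExp_mul_of_indep {Ω : Type v} {m mΩ : MeasurableSpace Ω} (hm : m ≤ mΩ) {P : Measure Ω}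
    [IsProbabilityMeasure P] {X Y : Ω → G} (hX : Measurable[m] X) (hY : Measurable Y)
    (hind : Indep m (MeasurableSpace.comap Y inferInstance) P) {ν : ProbabilityMeasure G}
    (hν : P.map Y = (ν : Measure G)) (f : C(G, ℝ)) :
    (fun ω => rightAvg ν f (X ω)) =ᵐ[P] P[fun ω => f (X ω * Y ω) | m] := by
  have hX' : Measurable X := hX.mono hm le_rfl
  have hXY : Measurable fun ω => f (X ω * Y ω) :=
    f.continuous.measurable.comp (hX'.mul hY)
  have hbd : ∀ x, ‖f x‖ ≤ ‖f‖ := fun x => f.norm_coe_le_norm x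
  refine ae_eq_condExp_of_forall_setIntegral_eq hm
    (Integrable.of_bound hXY.aestronglyMeasurable ‖f‖ (ae_of_all _ fun ω => hbd _))
    (fun s _ _ => (Integrable.of_bound
      ((rightAvg ν f).continuous.measurable.comp hX').aestronglyMeasurable ‖rightAvg ν f‖
      (ae_of_all _ fun ω => (rightAvg ν f).norm_coe_le_norm _)).integrableOn)
    (fun s hs _ => ?_)
    (((rightAvg ν f).continuous.measurable.comp hX).stronglyMeasurable.aestronglyMeasurable)
  -- Carrying the test event as a second coordinate makes `(X, χ)` independent of `Y`, so the
  -- identity becomes Fubini for a product law.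
  let χ : Ω → ℝ := s.indicator 1
  have hχ : Measurable[m] χ := measurable_const.indicator hs
  have hχ' : Measurable χ := hχ.mono hm le_rfl
  have hχb : ∀ ω, χ ω = 0 ∨ χ ω = 1 := fun ω => by
    by_cases h : ω ∈ s <;> simp [χ, h]
  have hZY : IndepFun (fun ω => (X ω, χ ω)) Y P :=
    indep_of_indep_of_le_left hind (hX.prodMk hχ).comap_le
  have hlaw := (indepFun_iff_map_prod_eq_prod_map_map (hX'.prodMk hχ').aemeasurable
    hY.aemeasurable).1 hZY
  have hφ : Measurable fun p : (G × ℝ) × G => p.1.2 * f (p.1.1 * p.2) := by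
    have : Continuous fun p : (G × ℝ) × G => p.1.2 * f (p.1.1 * p.2) := by fun_prop
    exact this.measurable
  have hind1 : ∀ g : Ω → ℝ, ∫ ω in s, g ω ∂P = ∫ ω, χ ω * g ω ∂P := fun g => by
    rw [← integral_indicator (hm s hs)]
    refine integral_congr_ae (ae_of_all _ fun ω => ?_)
    by_cases h : ω ∈ s <;> simp [χ, h]
  have hint : Integrable (fun p : (G × ℝ) × G => p.1.2 * f (p.1.1 * p.2))
      (P.map fun ω => ((X ω, χ ω), Y ω)) := by
    rw [integrable_map_measure hφ.aestronglyMeasurable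
      ((hX'.prodMk hχ').prodMk hY).aemeasurable]
    refine Integrable.of_bound (hφ.comp ((hX'.prodMk hχ').prodMk hY)).aestronglyMeasurable ‖f‖
      (ae_of_all _ fun ω => ?_)
    rcases hχb ω with h | h <;> simp [h, -Real.norm_eq_abs, hbd]
  rw [hind1, hind1]
  calc ∫ ω, χ ω * rightAvg ν f (X ω) ∂P
      = ∫ ω, (∫ y, χ ω * f (X ω * y) ∂(P.map Y)) ∂P := by
        simp only [rightAvg_apply, hν, integral_const_mul]
    _ = ∫ z, (∫ y, z.2 * f (z.1 * y) ∂(P.map Y)) ∂(P.map fun ω => (X ω, χ ω)) := by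
        rw [integral_map (hX'.prodMk hχ').aemeasurable]
        rw [hν]
        exact (hφ.stronglyMeasurable.integral_prod_right'
          (ν := (ν : Measure G))).aestronglyMeasurable
    _ = ∫ p, p.1.2 * f (p.1.1 * p.2) ∂(P.map fun ω => ((X ω, χ ω), Y ω)) := by
        rw [hlaw] at hint ⊢
        have := hY.aemeasurable (μ := P)
        have : IsProbabilityMeasure (P.map Y) := Measure.isProbabilityMeasure_map this
        exact (integral_prod _ hint).symm
    _ = ∫ ω, χ ω * f (X ω * Y ω) ∂P :=
        integral_map ((hX'.prodMk hχ').prodMk hY).aemeasurable hφ.aestronglyMeasurable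

/-- The averages of `f` over `lam` after the random walk form a bounded martingale, hence converge
almost surely. -/
lemma ae_exists_tendsto_rightAvg {μ lam : ℕ → ProbabilityMeasure G}
    (hlam : ∀ n, lam n = conv (μ n) (lam (n + 1))) {Ω : Type v} [mΩ : MeasurableSpace Ω]
    (P : Measure Ω) [IsProbabilityMeasure P] (ξ : ℕ → Ω → G) (hξ : ∀ n, Measurable (ξ n))
    (hind : iIndepFun ξ P) (hlaw : ∀ n, P.map (ξ n) = (μ n : Measure G)) (n : ℕ) (f : C(G, ℝ)) :
    ∀ᵐ ω ∂P, ∃ c : ℝ, Tendsto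
      (fun j => rightAvg (lam (n + j + 1)) f (partialProd (fun i => ξ i ω) n j)) atTop (𝓝 c) := by
  let 𝓕 : Filtration ℕ mΩ :=
    { seq := fun j => ⨆ i ∈ {i | i ≤ n + j}, MeasurableSpace.comap (ξ i) inferInstance
      mono' := fun j k hjk => biSup_mono fun i (hi : i ≤ n + j) => hi.trans (by lia)
      le' := fun j => iSup₂_le fun i _ => (hξ i).comap_le }
  have hξ𝓕 : ∀ i j, i ≤ n + j → Measurable[𝓕 j] (ξ i) := fun i j hij =>
    Measurable.of_comap_le (le_iSup₂_of_le (f := fun i (_ : i ∈ {i | i ≤ n + j}) =>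
      MeasurableSpace.comap (ξ i) inferInstance) i hij le_rfl)
  have hS : ∀ j, Measurable[𝓕 j] fun ω => partialProd (fun i => ξ i ω) n j := fun j => by
    induction j with
    | zero => exact hξ𝓕 n 0 le_rfl
    | succ j ih => exact (ih.mono (𝓕.mono j.le_succ) le_rfl).mul (hξ𝓕 _ _ le_rfl)
  have hind' : ∀ j, Indep (𝓕 j) (MeasurableSpace.comap (ξ (n + (j + 1))) inferInstance) P :=
    fun j => by
      have := indep_iSup_of_disjoint (fun k => (hξ k).comap_le) hind
        (S := {i | i ≤ n + j}) (T := {n + (j + 1)}) (by simp)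
      rwa [iSup_singleton] at this
  have hbd : ∀ (m : ℕ) (x : G), ‖rightAvg (lam m) f x‖ ≤ ‖f‖ := fun m x => by
    rw [rightAvg_apply]
    refine (norm_integral_le_of_norm_le_const (ae_of_all _ fun y => f.norm_coe_le_norm _)).trans ?_
    simp
  have hmart : Martingale
      (fun j ω => rightAvg (lam (n + j + 1)) f (partialProd (fun i => ξ i ω) n j)) 𝓕 P := by
    refine martingale_nat
      (fun j => ((rightAvg _ f).continuous.measurable.comp (hS j)).stronglyMeasurable)
      (fun j => Integrable.of_bound ((rightAvg _ f).continuous.measurable.comp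
        ((hS j).mono (𝓕.le j) le_rfl)).aestronglyMeasurable ‖f‖ (ae_of_all _ fun ω => hbd _ _))
      fun j => ?_
    -- Splitting one factor `μ` off `lam` leaves exactly the average over the next step of the walk.
    rw [hlam (n + j + 1), rightAvg_conv]
    exact condExp_mul_of_indep (𝓕.le j) (hS j) (hξ _) (hind' j) (hlaw _) _
  have := hmart.submartingale.ae_tendsto_limitProcess (R := ‖f‖₊) fun j => by
    refine (eLpNorm_le_of_ae_bound (ae_of_all _ fun ω => hbd _ _)).trans ?_
    simp
  filter_upwards [this] with ω hω using ⟨_, hω⟩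

/-- Countably many continuous functions separate the points of a compact metrizable space. -/
lemma exists_countable_separating (Q : Type*) [TopologicalSpace Q] [CompactSpace Q] [T2Space Q]
    [SecondCountableTopology Q] [Nonempty Q] :
    ∃ f : ℕ → C(Q, ℝ), ∀ x y, (∀ i, f i x = f i y) → x = y := by
  let := metrizableSpaceMetric Q
  refine ⟨fun i => ⟨fun x => dist x (denseSeq Q i), by fun_prop⟩, fun x y h => ?_⟩
  have hcl : IsClosed {q | dist x q = dist y q} := isClosed_eq (by fun_prop) (by fun_prop)
  have hd : Dense {q | dist x q = dist y q} :=
    (denseRange_denseSeq Q).mono (Set.range_subset_iff.2 h)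
  have : y ∈ closure {q | dist x q = dist y q} := hd y
  rw [hcl.closure_eq] at this
  simpa using this

/-- By compactness it suffices that all limit cosets along ultrafilters agree; the martingale limits
fix the value at them of each separating function. -/
theorem ae_tendsto_coset {μ lam : ℕ → ProbabilityMeasure G} {α : ℕ → G} {H : Subgroup G}
    (hH : IsCompact (H : Set G)) (hlam : ∀ n, lam n = conv (μ n) (lam (n + 1)))
    (hhaar : Tendsto (fun m : ℕ => conv (diracProba (α m)⁻¹) (lam (m + 1))) atTop
      (𝓝 (haarLaw H hH))) {Ω : Type v} [MeasurableSpace Ω]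
    (P : Measure Ω) [IsProbabilityMeasure P] (ξ : ℕ → Ω → G) (hξ : ∀ n, Measurable (ξ n))
    (hind : iIndepFun ξ P) (hlaw : ∀ n, P.map (ξ n) = (μ n : Measure G)) (n : ℕ) :
    ∀ᵐ ω ∂P, ∃ x : G ⧸ H,
      Tendsto (fun j : ℕ => ((partialProd (fun i => ξ i ω) n j * α (n + j) : G) : G ⧸ H))
        atTop (𝓝 x) := by
  have : IsClosed (H : Set G) := hH.isClosed
  have hmk : Continuous (QuotientGroup.mk : G → G ⧸ H) := continuous_quot_mk
  obtain ⟨f, hf⟩ := exists_countable_separating (G ⧸ H)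
  have hae := ae_all_iff.2 fun i =>
    ae_exists_tendsto_rightAvg hlam P ξ hξ hind hlaw n ((f i).comp ⟨_, hmk⟩)
  filter_upwards [hae] with ω hω
  choose c hc using hω
  set g : ℕ → G := fun j => partialProd (fun i => ξ i ω) n j * α (n + j) with hg
  have key : ∀ (U : Ultrafilter ℕ) (x : G), (U : Filter ℕ) ≤ atTop → Tendsto g U (𝓝 x) →
      ∀ i, f i x = c i := fun U x hU hx i => by
    have hshift : Tendsto (fun j => n + j) U atTop :=
      (tendsto_atTop_mono (fun j => Nat.le_add_left j n) tendsto_id).mono_left hU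
    have h1 := tendsto_conv_nhds (tendsto_dirac hx) (hhaar.comp hshift)
    have h2 := ((continuous_integral ((f i).comp ⟨_, hmk⟩)).tendsto _).comp h1
    refine tendsto_nhds_unique ?_ ((hc i).mono_left hU)
    convert h2 using 2
    -- The factor `α` in the walk cancels the `α⁻¹` of (I2), leaving the martingale.
    · rename_i j
      simp only [Function.comp_apply]
      rw [← conv_assoc, dirac_conv_dirac, integral_dirac_conv, rightAvg_apply]
      simp [hg]
    · rw [integral_dirac_conv]
      have : ∀ᵐ y ∂(haarLaw H hH : Measure G),
          ((f i).comp ⟨_, hmk⟩ : C(G, ℝ)) (x * y) = f i x := by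
        filter_upwards [ae_mem_haarLaw H hH] with y hy
        simp [QuotientGroup.mk_mul_of_mem x hy]
      rw [integral_congr_ae this]
      simp
  obtain ⟨x, hx⟩ := exists_tendsto_ultrafilter (hyperfilter ℕ) g
  refine ⟨x, (tendsto_iff_ultrafilter _ _ _).2 fun U hU => ?_⟩
  obtain ⟨y, hy⟩ := exists_tendsto_ultrafilter U g
  have hxy : (y : G ⧸ H) = x := hf _ _ fun i => by
    rw [key U y hU hy i, key _ x Nat.hyperfilter_le_atTop hx i]
  rw [← hxy]
  exact (hmk.tendsto y).comp hy

end AlmostSure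

/-! ### Existence of limit triples, and uniqueness up to translation. -/

section Main

variable {G : Type u} [Group G] [TopologicalSpace G] [IsTopologicalGroup G]
  [CompactSpace G] [T2Space G] [SecondCountableTopology G] [MeasurableSpace G] [BorelSpace G]

/-- If, along every ultrafilter, some limit of left translates of `ρ` is `ω`, then left
translations can be chosen so that the translates converge to `ω`. -/
lemma exists_tendsto_dirac_conv {ρ : ℕ → ProbabilityMeasure G} {ω : ProbabilityMeasure G}
    (h : ∀ U : Ultrafilter ℕ, (U : Filter ℕ) ≤ atTop →
      ∃ a : G, Tendsto (fun m => conv (diracProba a) (ρ m)) U (𝓝 ω)) :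
    ∃ α : ℕ → G, Tendsto (fun m => conv (diracProba (α m)⁻¹) (ρ m)) atTop (𝓝 ω) := by
  let := metrizableSpaceMetric (ProbabilityMeasure G)
  -- The given translate depends on the ultrafilter; a minimizer of the distance to `ω` does at
  -- least as well along all of them.
  have hmin : ∀ m, ∃ a : G, ∀ b : G, dist (conv (diracProba a) (ρ m)) ω ≤
      dist (conv (diracProba b) (ρ m)) ω := fun m => by
    have hc : Continuous fun a : G => dist (conv (diracProba a) (ρ m)) ω :=
      (continuous_conv.comp (continuous_diracProba.prodMk continuous_const)).dist continuous_const
    obtain ⟨a, -, ha⟩ := isCompact_univ.exists_isMinOn Set.univ_nonempty hc.continuousOn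
    exact ⟨a, fun b => ha (Set.mem_univ b)⟩
  choose β hβ using hmin
  refine ⟨fun m => (β m)⁻¹, ?_⟩
  simp only [inv_inv]
  refine (tendsto_iff_ultrafilter _ _ _).2 fun U hU => ?_
  obtain ⟨a, ha⟩ := h U hU
  exact tendsto_iff_dist_tendsto_zero.2 (squeeze_zero (fun _ => dist_nonneg) (fun m => hβ m a)
    (tendsto_iff_dist_tendsto_zero.1 ha))

/-- The factorization at `p` passes to the limit in `l`. The twist `β` is `1` when constructing
`lam` and `α` when proving (I1). -/
lemma tendsto_segConv_split (μ : ℕ → ProbabilityMeasure G) {U : Ultrafilter ℕ}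
    (hU : (U : Filter ℕ) ≤ atTop) {β : ℕ → G} {κ : ℕ → ProbabilityMeasure G}
    (hκ : ∀ n, Tendsto (fun l => conv (segConv μ n l) (diracProba (β l))) U (𝓝 (κ n)))
    {n p : ℕ} (hnp : n ≤ p) : κ n = conv (segConv μ n p) (κ (p + 1)) := by
  refine tendsto_nhds_unique (hκ n) ((tendsto_conv_nhds tendsto_const_nhds (hκ (p + 1))).congr' ?_)
  filter_upwards [hU (eventually_gt_atTop p)] with l hl
  rw [segConv_eq_conv μ hnp hl, conv_assoc]

theorem exists_isLimitTriple (μ : ℕ → ProbabilityMeasure G) :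
    ∃ (lam : ℕ → ProbabilityMeasure G) (α : ℕ → G) (H : Subgroup G),
      IsLimitTriple.{u, v} μ lam α H := by
  have hV : (hyperfilter ℕ : Filter ℕ) ≤ atTop := Nat.hyperfilter_le_atTop
  choose lam hlam using fun n => exists_tendsto_ultrafilter (hyperfilter ℕ) (segConv μ n)
  have hsplit : ∀ {n p : ℕ}, n ≤ p → lam n = conv (segConv μ n p) (lam (p + 1)) := fun hnp =>
    tendsto_segConv_split μ hV (β := fun _ => 1) (by simpa only [conv_dirac_one] using hlam) hnp
  obtain ⟨ν, hν⟩ := exists_tendsto_ultrafilter (hyperfilter ℕ) fun p => lam (p + 1)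
  have hlamν : ∀ n, conv (lam n) ν = lam n := fun n => by
    refine tendsto_nhds_unique ((tendsto_conv_nhds (hlam n) hν).congr' ?_) tendsto_const_nhds
    filter_upwards [hV (eventually_ge_atTop n)] with p hp using (hsplit hp).symm
  have hidem : conv ν ν = ν := by
    refine tendsto_nhds_unique (tendsto_conv_nhds hν tendsto_const_nhds) ?_
    simpa only [hlamν] using hν
  obtain ⟨H, hH, rfl⟩ := exists_eq_haarLaw_of_idempotent hidem
  have hinv : ∀ n, ∀ h ∈ H, conv (lam n) (diracProba h) = lam n := fun n h hh => by
    rw [← hlamν n, conv_assoc, haarLaw_conv_dirac H hH hh]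
  obtain ⟨α, hα⟩ : ∃ α : ℕ → G, Tendsto (fun m => conv (diracProba (α m)⁻¹) (lam (m + 1))) atTop
      (𝓝 (haarLaw H hH)) := by
    refine exists_tendsto_dirac_conv fun U hU => ?_
    obtain ⟨B, hB⟩ := exists_tendsto_ultrafilter U fun m => lam (m + 1)
    choose A hA using fun n => exists_tendsto_ultrafilter U (segConv μ n)
    have hAB : ∀ n, lam n = conv (A n) B := fun n => by
      refine tendsto_nhds_unique tendsto_const_nhds ((tendsto_conv_nhds (hA n) hB).congr' ?_)
      filter_upwards [hU (eventually_ge_atTop n)] with p hp using (hsplit hp).symm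
    -- Back along the original ultrafilter, where `lam (p + 1)` tends to `ω_H`: this exhibits `B` as
    -- a right factor of `ω_H`.
    obtain ⟨A', hA'⟩ := exists_tendsto_ultrafilter (hyperfilter ℕ) fun p => A (p + 1)
    have hA'B : conv A' B = haarLaw H hH := by
      refine tendsto_nhds_unique (tendsto_conv_nhds hA' tendsto_const_nhds) ?_
      simpa only [← hAB] using hν
    have hBinv : ∀ h ∈ H, conv B (diracProba h) = B := fun h hh => by
      refine tendsto_nhds_unique (tendsto_conv_nhds hB tendsto_const_nhds) ?_
      simpa only [hinv _ h hh] using hB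
    obtain ⟨a, ha⟩ := exists_dirac_conv_eq_haarLaw hH hA'B hBinv
    exact ⟨a, ha ▸ tendsto_conv_nhds tendsto_const_nhds hB⟩
  have hconv : ∀ n, Tendsto (fun l => conv (segConv μ n l) (diracProba (α l))) atTop
      (𝓝 (lam n)) := fun n => by
    refine (tendsto_iff_ultrafilter _ _ _).2 fun U hU => ?_
    choose κ hκ using fun n => exists_tendsto_ultrafilter U
      fun l => conv (segConv μ n l) (diracProba (α l))
    have hκH : ∀ n, conv (κ n) (haarLaw H hH) = lam n := fun n => by
      refine tendsto_nhds_unique ((tendsto_conv_nhds (hκ n) (hα.mono_left hU)).congr' ?_)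
        tendsto_const_nhds
      filter_upwards [hU (eventually_ge_atTop n)] with p hp
      rw [conv_assoc, dirac_conv_inv_cancel, ← hsplit hp]
    obtain ⟨K, hK⟩ := exists_tendsto_ultrafilter (hyperfilter ℕ) fun p => κ (p + 1)
    -- Here `segConv μ n p` tends to `lam n` because the limit in `p` is taken along the ultrafilter
    -- that defined `lam`.
    have hκK : κ n = conv (lam n) K := by
      refine tendsto_nhds_unique tendsto_const_nhds ((tendsto_conv_nhds (hlam n) hK).congr' ?_)
      filter_upwards [hV (eventually_ge_atTop n)] with p hp
        using (tendsto_segConv_split μ hU hκ hp).symm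
    have hKH : conv K (haarLaw H hH) = haarLaw H hH := by
      refine tendsto_nhds_unique (tendsto_conv_nhds hK tendsto_const_nhds) ?_
      simpa only [hκH] using hν
    have := conv_eq_left_of_ae_mem (H := (H : Set G)) (ae_mem_of_conv_haarLaw hH hKH) (hinv n)
    rw [← this, ← hκK]
    exact hκ n
  refine ⟨lam, α, H, hH, fun n => ?_, hα, hinv, fun Ω _ P _ ξ hξ hind hlaw n => ?_⟩
  · have hshift : Tendsto (fun j => n + j) atTop atTop :=
      tendsto_atTop_mono (fun j => Nat.le_add_left j n) tendsto_id
    simpa [Function.comp_def, segConv] using (hconv n).comp hshift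
  · refine ae_tendsto_coset hH (fun n => ?_) hα P ξ hξ hind hlaw n
    rw [← segConv_self μ n]
    exact hsplit le_rfl

/-- If the Haar law of `H'` is the conjugate by `g` of that of `H`, then `H' ⊆ g⁻¹ H g`. -/
lemma subset_conj_of_haarLaw_eq {H H' : Subgroup G} (hH : IsCompact (H : Set G))
    (hH' : IsCompact (H' : Set G)) {g : G}
    (h : haarLaw H' hH' = conv (conv (diracProba g⁻¹) (haarLaw H hH)) (diracProba g)) {x : G}
    (hx : x ∈ H') : g * x * g⁻¹ ∈ H := by
  have hcl : IsClosed {x : G | g * x * g⁻¹ ∈ H} :=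
    hH.isClosed.preimage (f := fun x => g * x * g⁻¹) (by fun_prop)
  refine subset_of_ae_mem_haarLaw H' hH' hcl ?_ hx
  change (haarLaw H' hH' : Measure G) {x : G | g * x * g⁻¹ ∈ H}ᶜ = 0
  have hm := hcl.measurableSet.compl
  rw [h, conv_dirac_apply g _ hm, dirac_conv_apply _ _ (measurable_mul_const g hm)]
  refine measure_mono_null (t := (H : Set G)ᶜ) (fun y hy hyH => hy ?_) (ae_mem_haarLaw H hH)
  simpa [mul_assoc] using hyH

theorem IsLimitTriple.unique {μ lam lam' : ℕ → ProbabilityMeasure G} {α α' : ℕ → G}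
    {H H' : Subgroup G} (h : IsLimitTriple.{u, v} μ lam α H)
    (h' : IsLimitTriple.{u, v} μ lam' α' H') {g : G}
    (hg : MapClusterPt g atTop fun m : ℕ => (α m)⁻¹ * α' m) :
    (∀ n : ℕ, lam' n = conv (lam n) (diracProba g)) ∧
      (H' : Set G) = (fun h : G => g⁻¹ * h * g) '' (H : Set G) := by
  obtain ⟨U, hU, hUg⟩ := mapClusterPt_iff_ultrafilter.1 hg
  have hlam : ∀ n, lam' n = conv (lam n) (diracProba g) := fun n => by
    -- Reindexing by `l = n + j` lets the same ultrafilter `U` serve every `n`.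
    have hshift : Tendsto (fun l => l - n) U atTop := (tendsto_sub_atTop_nat n).mono_left hU
    refine tendsto_nhds_unique ((h'.tendsto_conv n).comp hshift)
      ((tendsto_conv_nhds ((h.tendsto_conv n).comp hshift) (tendsto_dirac hUg)).congr' ?_)
    filter_upwards [hU (eventually_ge_atTop n)] with l hl
    simp [Function.comp_apply, Nat.add_sub_cancel' hl, conv_assoc, dirac_conv_dirac]
  have hconj : haarLaw H' h'.isCompact =
      conv (conv (diracProba g⁻¹) (haarLaw H h.isCompact)) (diracProba g) := by
    refine tendsto_nhds_unique (h'.tendsto_haar.mono_left hU) ((tendsto_conv_nhds (tendsto_conv_nhds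
      (tendsto_dirac hUg.inv) (h.tendsto_haar.mono_left hU)) tendsto_const_nhds).congr fun m => ?_)
    rw [hlam, ← conv_assoc, ← conv_assoc, dirac_conv_dirac]
    simp
  have hconj' : haarLaw H h.isCompact =
      conv (conv (diracProba g⁻¹⁻¹) (haarLaw H' h'.isCompact)) (diracProba g⁻¹) := by
    rw [hconj, inv_inv, ← conv_assoc, dirac_conv_inv_cancel, conv_assoc, dirac_conv_dirac,
      mul_inv_cancel, conv_dirac_one]
  refine ⟨hlam, Set.Subset.antisymm (fun x hx => ?_) ?_⟩
  · exact ⟨_, subset_conj_of_haarLaw_eq h.isCompact h'.isCompact hconj hx, by group⟩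
  · rintro _ ⟨x, hx, rfl⟩
    simpa using subset_conj_of_haarLaw_eq h'.isCompact h.isCompact hconj' hx

end Main

end InfiniteConvolution

theorem mainTheorem3 {G : Type u} [Group G] [TopologicalSpace G] [IsTopologicalGroup G]
    [CompactSpace G] [T2Space G] [SecondCountableTopology G] [MeasurableSpace G] [BorelSpace G]
    (μ : ℕ → ProbabilityMeasure G) :
    (∃ (lam : ℕ → ProbabilityMeasure G) (α : ℕ → G) (H : Subgroup G),
      InfiniteConvolution.IsLimitTriple.{u, v} μ lam α H) ∧
    (∀ (lam lam' : ℕ → ProbabilityMeasure G) (α α' : ℕ → G) (H H' : Subgroup G),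
      InfiniteConvolution.IsLimitTriple.{u, v} μ lam α H →
      InfiniteConvolution.IsLimitTriple.{u, v} μ lam' α' H' →
      ∀ g : G, MapClusterPt g atTop (fun m : ℕ => (α m)⁻¹ * α' m) →
        (∀ n : ℕ, lam' n = InfiniteConvolution.conv (lam n) (diracProba g)) ∧
        (H' : Set G) = (fun h : G => g⁻¹ * h * g) '' (H : Set G)) := by
  exact ⟨InfiniteConvolution.exists_isLimitTriple μ, fun _ _ _ _ _ _ h h' _ hg => h.unique h' hg⟩
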